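/- A graph is a simple graph $G=(V,E)$ with $V\subseteq\omega$; it is represented by the element of $\omega^\omega$ that is the join of the characteristic functions of $V$ and of $E$, where an edge $\{x,y\}$ with $x<y$ is coded by the pair $(x,y)$. A subset of $\omega$ is represented by its characteristic function. Write $N(v)$ for the set of neighbours of $v$; $G$ is locally finite if $N(v)$ is finite for every $v\in V$. Let $\mathsf{RSg}$ be the problem whose instances are the infinite graphs $G=(V,E)$ and whose solutions to $G$ are the infinite sets $H\subseteq V$ such that, for every $v\in V$, $H\cap N(v)$ is infinite or $|H\cap N(v)|\le 1$. Let $\mathsf{RSgr}$ be the problem with the same instances whose solutions are the $\mathsf{RSg}$-solutions $H$ such that, in addition, for every $v\in H$, $H\cap N(v)$ is infinite or empty. Let $\mathsf{RSg}{\restriction}_{\mathrm{LF}}$ and $\mathsf{RSgr}{\restriction}_{\mathrm{LF}}$ be their restrictions to infinite locally finite graphs. Let $\lim$ be the problem whose instances are the functions $f\colon\omega\times\omega\to\omega$ (regarded as elements of $\omega^\omega$ via a computable pairing) such that $g(n)=\lim_s f(n,s)$ exists for every $n$, and whose only solution to $f$ is $g$. For problems $\mathcal F,\mathcal G$ on $\omega^\omega$,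 $\mathcal F\le_{\mathrm{sW}}\mathcal G$ means that there are Turing functionals $\Phi,\Psi$ such that, for every $\mathcal F$-instance $f$, $\Phi(f)$ is defined and is a $\mathcal G$-instance, and for every $\mathcal G$-solution $g$ to $\Phi(f)$, $\Psi(g)$ is defined and is an $\mathcal F$-solution to $f$; and $\mathcal F\equiv_{\mathrm{sW}}\mathcal G$ (strong Weihrauch equivalence) means $\mathcal F\le_{\mathrm{sW}}\mathcal G$ and $\mathcal G\le_{\mathrm{sW}}\mathcal F$. **Proposition.** $\mathsf{RSg}{\restriction}_{\mathrm{LF}}\equiv_{\mathrm{sW}}\mathsf{RSgr}{\restriction}_{\mathrm{LF}}\equiv_{\mathrm{sW}}\lim$. In particular, $\mathsf{RSg}{\restriction}_{\mathrm{LF}}$ and $\mathsf{RSgr}{\restriction}_{\mathrm{LF}}$ are both strongly Weihrauch equivalent to $\lim$. -/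

import Mathlib

namespace Weihrauch

/-- Programs for Turing functionals: the schemes generating the partial recursive functions
(the constructors of `Nat.Partrec`), together with one query instruction `oracle`. -/
inductive TuringFunctional : Type
  | zero : TuringFunctional
  | succ : TuringFunctional
  | left : TuringFunctional
  | right : TuringFunctional
  | oracle : TuringFunctional
  | pair : TuringFunctional → TuringFunctional → TuringFunctional
  | comp : TuringFunctional → TuringFunctional → TuringFunctional
  | prec : TuringFunctional → TuringFunctional → TuringFunctional
  | rfind : TuringFunctional → TuringFunctional

namespace TuringFunctional

/-- The partial function `ℕ →. ℕ` computed by a program with oracle `p`. The clauses are those of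
Mathlib's `Nat.RecursiveIn`, but the program is fixed before the oracle is given, so that the
dependence on the oracle is uniform. -/
def eval (p : ℕ → ℕ) : TuringFunctional → ℕ →. ℕ
  | zero => fun _ => Part.some 0
  | succ => fun n => Part.some (n + 1)
  | left => fun n => Part.some n.unpair.1
  | right => fun n => Part.some n.unpair.2
  | oracle => fun n => Part.some (p n)
  | pair c d => fun n => Nat.pair <$> eval p c n <*> eval p d n
  | comp c d => fun n => eval p d n >>= eval p c
  | prec c d => fun m =>
      Nat.rec (eval p c m.unpair.1)
        (fun y IH => IH >>= fun i => eval p d (Nat.pair m.unpair.1 (Nat.pair y i))) m.unpair.2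
  | rfind c => fun a => Nat.rfind fun n => (fun m => decide (m = 0)) <$> eval p c (Nat.pair a n)

/-- `Φ.Maps p q`: the value `Φ(p)` of the partial function `Φ :⊆ ω^ω → ω^ω` is defined (the
computation with oracle `p` halts on every input) and is equal to `q`. -/
def Maps (Φ : TuringFunctional) (p q : ℕ → ℕ) : Prop :=
  ∀ n, q n ∈ Φ.eval p n

end TuringFunctional

/-- A multi-valued partial function on `ω^ω`, thought of as a mathematical problem:
`dom` is the set of instances, and `sol p` is the set of solutions to an instance `p`
(the values of `sol` outside `dom` are irrelevant). -/
structure Problem where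
  dom : Set (ℕ → ℕ)
  sol : (ℕ → ℕ) → Set (ℕ → ℕ)

namespace Problem

/-- The restriction of a problem to the instances in `S`. -/
def restrict (F : Problem) (S : Set (ℕ → ℕ)) : Problem where
  dom := F.dom ∩ S
  sol := F.sol

/-- Strong Weihrauch reducibility `F ≤_sW G`: there are Turing functionals `Φ`, `Ψ` such that
`Φ(f) ∈ dom G` for all `f ∈ dom F`, and `Ψ(g) ∈ F(f)` for all `f ∈ dom F` and `g ∈ G(Φ(f))`. -/
def StrongReducible (F G : Problem) : Prop :=
  ∃ Φ Ψ : TuringFunctional, ∀ f ∈ F.dom,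
    ∃ w ∈ G.dom, Φ.Maps f w ∧ ∀ g ∈ G.sol w, ∃ h ∈ F.sol f, Ψ.Maps g h

/-- Strong Weihrauch equivalence `F ≡_sW G`. -/
def StrongEquiv (F G : Problem) : Prop :=
  F.StrongReducible G ∧ G.StrongReducible F

end Problem

/-- A simple graph `G = (V, E)` whose set `V = G.verts` of vertices is a set of natural numbers. -/
abbrev NatGraph : Type := (⊤ : SimpleGraph ℕ).Subgraph

open Classical in
/-- The characteristic function of a set of natural numbers. -/
noncomputable def charFn (A : Set ℕ) : ℕ → ℕ :=
  fun n => if n ∈ A then 1 else 0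

/-- The join `⟨p, q⟩`, with `⟨p, q⟩(2n) = p(n)` and `⟨p, q⟩(2n+1) = q(n)`. -/
def join (p q : ℕ → ℕ) : ℕ → ℕ :=
  fun n => if n % 2 = 0 then p (n / 2) else q (n / 2)

namespace NatGraph

/-- The edge set `E ⊆ [V]²`, an edge `{x, y}` with `x < y` being coded as the pair `(x, y)`. -/
def edgeCodes (G : NatGraph) : Set ℕ :=
  {e | e.unpair.1 < e.unpair.2 ∧ G.Adj e.unpair.1 e.unpair.2}

/-- The point of `ω^ω` that represents the graph `G = (V, E)`: the join of the characteristic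
functions of `V` and `E`. -/
noncomputable def code (G : NatGraph) : ℕ → ℕ :=
  join (charFn G.verts) (charFn (edgeCodes G))

/-- Every vertex has only finitely many neighbours. -/
def IsLocallyFinite (G : NatGraph) : Prop :=
  ∀ v ∈ G.verts, (G.neighborSet v).Finite

/-- `H ⊆ V` is infinite, and every `v ∈ V` has infinitely many or at most one neighbour in `H`. -/
def IsRSgSolution (G : NatGraph) (H : Set ℕ) : Prop :=
  H.Infinite ∧ H ⊆ G.verts ∧
    ∀ v ∈ G.verts, (H ∩ G.neighborSet v).Infinite ∨ (H ∩ G.neighborSet v).encard ≤ 1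

/-- In addition, every `v ∈ H` has infinitely many or no neighbours in `H`. -/
def IsRSgrSolution (G : NatGraph) (H : Set ℕ) : Prop :=
  IsRSgSolution G H ∧
    ∀ v ∈ H, (H ∩ G.neighborSet v).Infinite ∨ H ∩ G.neighborSet v = ∅

end NatGraph

/-- The Rival--Sands theorem for graphs, as a problem. -/
def RSg : Problem where
  dom := {p | ∃ G : NatGraph, G.verts.Infinite ∧ p = NatGraph.code G}
  sol p := {q | ∃ (G : NatGraph) (H : Set ℕ),
    p = NatGraph.code G ∧ q = charFn H ∧ NatGraph.IsRSgSolution G H}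

/-- The refined Rival--Sands theorem for graphs, as a problem. -/
def RSgr : Problem where
  dom := {p | ∃ G : NatGraph, G.verts.Infinite ∧ p = NatGraph.code G}
  sol p := {q | ∃ (G : NatGraph) (H : Set ℕ),
    p = NatGraph.code G ∧ q = charFn H ∧ NatGraph.IsRSgrSolution G H}

/-- The set of all codes of locally finite graphs. -/
def locallyFiniteCodes : Set (ℕ → ℕ) :=
  {p | ∃ G : NatGraph, NatGraph.IsLocallyFinite G ∧ p = NatGraph.code G}

/-- `RSg` restricted to infinite locally finite graphs. -/
def RSgLF : Problem := RSg.restrict locallyFiniteCodes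

/-- `RSgr` restricted to infinite locally finite graphs. -/
def RSgrLF : Problem := RSgr.restrict locallyFiniteCodes

/-- `g = lim f`: for every `n`, `f(n, s) = g(n)` for all sufficiently large `s`, where
`f : ω × ω → ω` is regarded as an element of `ω^ω` by means of the pairing function. -/
def IsLim (f g : ℕ → ℕ) : Prop :=
  ∀ n, ∃ s₀, ∀ s ≥ s₀, f (Nat.pair n s) = g n

/-- The limit operation, as a problem. -/
def limProblem : Problem where
  dom := {f | ∃ g, IsLim f g}
  sol f := {g | IsLim f g}

end Weihrauch

/-! The three problems lie on a cycle of reductions: `RSgLF` to `RSgrLF` to `limProblem` to `RSgLF`.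
The first is the identity. For the second, choose vertices greedily at pairwise distance greater
than two. Local finiteness keeps the choice infinite (`infinite_greedySet`), and the result is a
refined solution (`isRSgrSolution_greedySet`). Finding a common neighbour is an unbounded search;
cutting it off at stage `s` gives a computable approximation that converges (`isLim_greedyApprox`).
For the third, the vertices of `limGraph f` are the finite sequences `f(0,s), ..., f(s-1,s)`, so a
solution carries values of `f` although the backward functional never sees `f`. Stage `s` is joined
to a later `t` if some `f(n,·)` with `n ≤ s` changes at `t`. Convergence of `f` makes the graph
locally finite. If `x` and `y` are in the solution, `x` being shorter, and a value up to the length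
of `x` changed after stage `y`, the stage of that change would have both as neighbours, which is
impossible; so `y` lists true limits there (`IsLim.eq_of_mem_solution`). Computability is reduced to
`Primrec` on oracle prefixes (`UniformlyComputable.of_use`) and one unbounded search
(`UniformlyComputable.exists_search`). -/

namespace Weihrauch

/-! ### Composition of Turing functionals -/

namespace TuringFunctional

/-- The program obtained from `c` by replacing every query by a run of `Φ`. -/
def subst (Φ : TuringFunctional) : TuringFunctional → TuringFunctional
  | zero => zero
  | succ => succ
  | left => left
  | right => right
  | oracle => Φ
  | pair c d => pair (subst Φ c) (subst Φ d)
  | comp c d => comp (subst Φ c) (subst Φ d)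
  | prec c d => prec (subst Φ c) (subst Φ d)
  | rfind c => rfind (subst Φ c)

theorem Maps.eval_subst {Φ : TuringFunctional} {p q : ℕ → ℕ} (h : Φ.Maps p q)
    (c : TuringFunctional) : (subst Φ c).eval p = c.eval q := by
  induction c with
  | oracle => funext n; exact Part.eq_some_iff.2 (h n)
  | pair c d hc hd => simp only [subst, eval, hc, hd]; rfl
  | comp c d hc hd => simp only [subst, eval, hc, hd]; rfl
  | prec c d hc hd => simp only [subst, eval, hc, hd]; rfl
  | rfind c hc => simp only [subst, eval, hc]; rfl
  | _ => rfl

theorem Maps.subst {Φ Ψ : TuringFunctional} {p q r : ℕ → ℕ} (h : Φ.Maps p q) (h' : Ψ.Maps q r) :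
    (subst Φ Ψ).Maps p r := fun n => by
  rw [h.eval_subst]; exact h' n

theorem mem_eval_pair {c d : TuringFunctional} {p : ℕ → ℕ} {n a b : ℕ}
    (hc : a ∈ c.eval p n) (hd : b ∈ d.eval p n) : Nat.pair a b ∈ (pair c d).eval p n := by
  change _ ∈ Nat.pair <$> c.eval p n <*> d.eval p n
  simp [Part.eq_some_iff.2 hc, Part.eq_some_iff.2 hd, Seq.seq]

theorem mem_eval_comp {c d : TuringFunctional} {p : ℕ → ℕ} {n a b : ℕ}
    (hd : a ∈ d.eval p n) (hc : b ∈ c.eval p a) : b ∈ (comp c d).eval p n :=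
  Part.mem_bind hd hc

theorem maps_oracle (p : ℕ → ℕ) : oracle.Maps p p := fun _ => Part.mem_some _

end TuringFunctional

open TuringFunctional

theorem Problem.StrongReducible.trans {F G K : Problem} (h₁ : F.StrongReducible G)
    (h₂ : G.StrongReducible K) : F.StrongReducible K := by
  obtain ⟨Φ₁, Ψ₁, h₁⟩ := h₁
  obtain ⟨Φ₂, Ψ₂, h₂⟩ := h₂
  refine ⟨Φ₁.subst Φ₂, Ψ₂.subst Ψ₁, fun f hf => ?_⟩
  obtain ⟨u, hu, hfu, hu'⟩ := h₁ f hf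
  obtain ⟨w, hw, huw, hw'⟩ := h₂ u hu
  refine ⟨w, hw, hfu.subst huw, fun g hg => ?_⟩
  obtain ⟨a, ha, hga⟩ := hw' g hg
  obtain ⟨b, hb, hab⟩ := hu' a ha
  exact ⟨b, hb, hga.subst hab⟩

/-! ### Uniformly computable operators -/

/-- A total operator on `ω^ω` that is computed by a Turing functional. -/
def UniformlyComputable (F : (ℕ → ℕ) → ℕ → ℕ) : Prop :=
  ∃ Φ : TuringFunctional, ∀ p, Φ.Maps p (F p)

namespace UniformlyComputable

variable {F G : (ℕ → ℕ) → ℕ → ℕ}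

theorem oracle : UniformlyComputable fun p n => p n :=
  ⟨.oracle, maps_oracle⟩

theorem pair (hF : UniformlyComputable F) (hG : UniformlyComputable G) :
    UniformlyComputable fun p n => Nat.pair (F p n) (G p n) := by
  obtain ⟨Φ, hΦ⟩ := hF
  obtain ⟨Ψ, hΨ⟩ := hG
  exact ⟨.pair Φ Ψ, fun p n => mem_eval_pair (hΦ p n) (hΨ p n)⟩

theorem comp (hF : UniformlyComputable F) (hG : UniformlyComputable G) :
    UniformlyComputable fun p n => F p (G p n) := by
  obtain ⟨Φ, hΦ⟩ := hF
  obtain ⟨Ψ, hΨ⟩ := hG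
  exact ⟨.comp Φ Ψ, fun p n => mem_eval_comp (hΨ p n) (hΦ p _)⟩

theorem prec (hF : UniformlyComputable F) (hG : UniformlyComputable G) :
    UniformlyComputable fun p n => Nat.rec (F p n.unpair.1)
      (fun y IH => G p (Nat.pair n.unpair.1 (Nat.pair y IH))) n.unpair.2 := by
  obtain ⟨Φ, hΦ⟩ := hF
  obtain ⟨Ψ, hΨ⟩ := hG
  refine ⟨.prec Φ Ψ, fun p n => ?_⟩
  simp only [eval]
  induction n.unpair.2 with
  | zero => exact hΦ p _
  | succ k ih => exact Part.mem_bind ih (hΨ p _)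

theorem of_natPrimrec {f : ℕ → ℕ} (hf : Nat.Primrec f) : UniformlyComputable fun _ => f := by
  induction hf with
  | zero => exact ⟨.zero, fun _ _ => Part.mem_some _⟩
  | succ => exact ⟨.succ, fun _ _ => Part.mem_some _⟩
  | left => exact ⟨.left, fun _ _ => Part.mem_some _⟩
  | right => exact ⟨.right, fun _ _ => Part.mem_some _⟩
  | pair _ _ hf hg => exact hf.pair hg
  | comp _ _ hf hg => exact hf.comp hg
  | prec _ _ hf hg => exact hf.prec hg

theorem of_primrec {f : ℕ → ℕ} (hf : Primrec f) : UniformlyComputable fun _ => f :=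
  of_natPrimrec (Primrec.nat_iff.1 hf)

-- Primitive recursion on `n`, appending one queried value per step. This confines all oracle access
-- to one number, so that the rest is `Primrec`.
open Encodable in
theorem encode_map_range :
    UniformlyComputable fun p n => encode ((List.range n).map p) := by
  let step : ℕ → ℕ := fun m =>
    encode (Denumerable.ofNat (List ℕ) m.unpair.1 ++ [m.unpair.2])
  have hstep : Primrec step := by
    refine Primrec.encode.comp (Primrec.list_append.comp
      ((Primrec.ofNat _).comp (Primrec.fst.comp Primrec.unpair))
      (Primrec.list_cons.comp (Primrec.snd.comp Primrec.unpair) (Primrec.const [])))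
  have hleft : Primrec fun m : ℕ => m.unpair.1 := Primrec.fst.comp Primrec.unpair
  have hright : Primrec fun m : ℕ => m.unpair.2 := Primrec.snd.comp Primrec.unpair
  have hrec := ((of_primrec (Primrec.const (encode ([] : List ℕ)))).prec
    ((of_primrec hstep).comp
      ((of_primrec (hright.comp hright)).pair
        (oracle.comp (of_primrec (hleft.comp hright)))))).comp
    -- The recursion has no parameter; the slot is filled by a dummy 0.
    (of_primrec (Primrec₂.natPair.comp (Primrec.const 0) Primrec.id))
  convert hrec using 3 with p n
  simp only [id, Nat.unpair_pair] at *
  induction n with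
  | zero => rfl
  | succ n ih =>
    refine Eq.trans ?_ (congrArg (fun z => step (Nat.pair z (p n))) ih)
    simp [List.range_succ, step]

theorem of_prefix {b : ℕ → ℕ} {g : List ℕ → ℕ → ℕ} (hb : Primrec b) (hg : Primrec₂ g) :
    UniformlyComputable fun p n => g ((List.range (b n)).map p) n := by
  have hG : Primrec fun m : ℕ => g (Denumerable.ofNat (List ℕ) m.unpair.1) m.unpair.2 :=
    hg.comp ((Primrec.ofNat _).comp (Primrec.fst.comp Primrec.unpair))
      (Primrec.snd.comp Primrec.unpair)
  simpa using (of_primrec hG).comp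
    ((encode_map_range.comp (of_primrec hb)).pair (of_primrec Primrec.id))

/-- The output `G` of an unbounded search for a zero of `F` is computed by a Turing functional. -/
theorem exists_search (hF : UniformlyComputable F) (hG : UniformlyComputable G) :
    ∃ Φ : TuringFunctional, ∀ p q : ℕ → ℕ,
      (∀ n, ∃ k, F p (Nat.pair n k) = 0) →
      (∀ n k, F p (Nat.pair n k) = 0 → G p (Nat.pair n k) = q n) → Φ.Maps p q := by
  obtain ⟨Φ, hΦ⟩ := hF
  obtain ⟨Ψ, hΨ⟩ := hG
  -- The identity program hands the input on to `Ψ` together with the number found.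
  obtain ⟨I, hI⟩ := of_primrec Primrec.id
  refine ⟨.comp Ψ (.pair I (.rfind Φ)), fun p q h h' n => ?_⟩
  have hmin := Nat.find_spec (h n)
  set k := Nat.find (h n) with hk
  have hr : k ∈ (TuringFunctional.rfind Φ).eval p n := by
    simp only [eval]
    refine Nat.mem_rfind.2 ⟨?_, fun {m} hm => ?_⟩
    · simp [Part.eq_some_iff.2 (hΦ p (Nat.pair n k)), hmin]
    · simp [Part.eq_some_iff.2 (hΦ p (Nat.pair n m)), Nat.find_min (h n) hm]
  rw [← h' n k hmin]
  exact mem_eval_comp (mem_eval_pair (hI p n) hr) (hΨ p _)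

end UniformlyComputable

/-! ### Coding of graphs -/


theorem charFn_eq_one {A : Set ℕ} {n : ℕ} : charFn A n = 1 ↔ n ∈ A := by
  simp [charFn]

theorem charFn_congr {A B : Set ℕ} {m n : ℕ} (h : m ∈ A ↔ n ∈ B) : charFn A m = charFn B n := by
  by_cases hA : m ∈ A
  · rw [charFn_eq_one.2 hA, charFn_eq_one.2 (h.1 hA)]
  · have hB : n ∉ B := fun hB => hA (h.2 hB)
    simp [charFn, hA, hB]

open Classical in
theorem primrec_charFn {α : Type*} [Primcodable α] {A : α → Set ℕ} {f : α → ℕ}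
    (h : PrimrecPred fun a => f a ∈ A a) : Primrec fun a => charFn (A a) (f a) :=
  (Primrec.ite h (Primrec.const 1) (Primrec.const 0)).of_eq fun a => by
    by_cases ha : f a ∈ A a <;> simp [charFn, ha]

theorem charFn_injective : Function.Injective charFn := fun A B h => by
  ext n; rw [← charFn_eq_one, h, charFn_eq_one]

namespace NatGraph

theorem code_two_mul (G : NatGraph) (n : ℕ) : G.code (2 * n) = charFn G.verts n := by
  simp [code, join]

theorem code_two_mul_add_one (G : NatGraph) (n : ℕ) :
    G.code (2 * n + 1) = charFn G.edgeCodes n := by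
  have h : (2 * n + 1) / 2 = n := by omega
  simp [code, join, Nat.add_mod, h]

/-- Solutions are stated for some graph with the given code; this identifies it with the instance at
hand. -/
theorem code_injective : Function.Injective code := fun G K h => by
  have hE : G.edgeCodes = K.edgeCodes := charFn_injective <| funext fun n => by
    rw [← code_two_mul_add_one, h, code_two_mul_add_one]
  have key : ∀ a b, a < b → (G.Adj a b ↔ K.Adj a b) := fun a b hab => by
    have : Nat.pair a b ∈ G.edgeCodes ↔ Nat.pair a b ∈ K.edgeCodes := by rw [hE]
    simpa [edgeCodes, hab] using this
  apply SimpleGraph.Subgraph.ext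
  · exact charFn_injective <| funext fun n => by rw [← code_two_mul, h, code_two_mul]
  · ext a b
    rcases lt_trichotomy a b with hab | rfl | hab
    · exact key a b hab
    · exact ⟨fun h => (h.ne rfl).elim, fun h => (h.ne rfl).elim⟩
    · rw [G.adj_comm, K.adj_comm]; exact key b a hab

end NatGraph
-- Use bounds and bounded quantifiers
theorem pair_le_pair {a b c : ℕ} (ha : a ≤ c) (hb : b ≤ c) : Nat.pair a b ≤ Nat.pair c c := by
  rcases ha.lt_or_eq with ha | rfl
  · refine (Nat.pair_lt_pair_left b ha).le.trans ?_
    rcases hb.lt_or_eq with hb | rfl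
    · exact (Nat.pair_lt_pair_right _ hb).le
    · exact le_rfl
  · rcases hb.lt_or_eq with hb | rfl
    · exact (Nat.pair_lt_pair_right _ hb).le
    · exact le_rfl

/-- An operator is uniformly computable if it is primitive recursive in a finite part of the
oracle whose length is primitive recursive in the input. -/
theorem UniformlyComputable.of_use {F : (ℕ → ℕ) → ℕ → ℕ} {b : ℕ → ℕ} (hb : Primrec b)
    (hF : Primrec₂ fun (l : List ℕ) n => F (fun i => l.getD i 0) n)
    (huse : ∀ p q n, (∀ i < b n, p i = q i) → F p n = F q n) : UniformlyComputable F := by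
  convert UniformlyComputable.of_prefix hb hF using 3 with p n
  -- Past the prefix the list reads 0, which the use bound makes harmless.
  refine huse _ _ _ fun i hi => ?_
  simp [List.getD_eq_getElem?_getD, hi]

theorem _root_.PrimrecRel.exists_lt' {α : Type*} [Primcodable α] {R : ℕ → α → Prop}
    (hR : PrimrecRel R) : PrimrecRel fun n a => ∃ x < n, R x a :=
  (hR.exists_mem_list.comp (Primrec.list_range.comp Primrec.fst) Primrec.snd).of_eq (by simp)

theorem _root_.PrimrecRel.forall_lt' {α : Type*} [Primcodable α] {R : ℕ → α → Prop}
    (hR : PrimrecRel R) : PrimrecRel fun n a => ∀ x < n, R x a :=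
  (hR.forall_mem_list.comp (Primrec.list_range.comp Primrec.fst) Primrec.snd).of_eq (by simp)

/-! ### The greedy construction -/

open Classical in
/-- Adds `n` to the list `L` if `n` belongs to `V` and no element of `L` is related to it. -/
noncomputable def greedyStep (V : ℕ → Prop) (R : ℕ → ℕ → Prop) (n : ℕ) (L : List ℕ) : List ℕ :=
  if V n ∧ ∀ y ∈ L, ¬ R y n then n :: L else L

/-- The elements below `n` of the subset of `V` that is chosen greedily such that no two of its
elements are related by `R`. -/
noncomputable def greedyList (V : ℕ → Prop) (R : ℕ → ℕ → Prop) : ℕ → List ℕ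
  | 0 => []
  | n + 1 => greedyStep V R n (greedyList V R n)

/-- The subset of `V` that is chosen greedily such that no two of its elements are related
by `R`. -/
def greedySet (V : ℕ → Prop) (R : ℕ → ℕ → Prop) : Set ℕ :=
  {n | n ∈ greedyList V R (n + 1)}

section greedy

variable {V V' : ℕ → Prop} {R R' : ℕ → ℕ → Prop}

theorem mem_greedyList {m n : ℕ} : m ∈ greedyList V R n ↔ m < n ∧ m ∈ greedySet V R := by
  induction n with
  | zero => simp [greedyList]
  | succ n ih =>
    rcases lt_trichotomy m n with h | rfl | h
    · have : m ∈ greedyList V R (n + 1) ↔ m ∈ greedyList V R n := by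
        rw [greedyList, greedyStep]; split_ifs <;> simp [h.ne]
      rw [this, ih]
      simp [h, h.trans (Nat.lt_succ_self n)]
    · simp [greedySet]
    · have h' : ¬ m < n + 1 := by omega
      have h'' : ¬ m < n := by omega
      rw [greedyList, greedyStep]; split_ifs <;> simp [h', h'', h.ne', ih]

theorem mem_greedySet {n : ℕ} :
    n ∈ greedySet V R ↔ V n ∧ ∀ y < n, y ∈ greedySet V R → ¬ R y n := by
  have hn : n ∉ greedyList V R n := fun h => (mem_greedyList.1 h).1.false
  have : n ∈ greedySet V R ↔ V n ∧ ∀ y ∈ greedyList V R n, ¬ R y n := by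
    rw [greedySet, Set.mem_ofPred_eq, greedyList, greedyStep]
    split_ifs with h
    · simpa using h
    · simpa [hn] using h
  simp only [this, mem_greedyList, and_imp]

/-- This locality serves twice: for the use bound and for the convergence of the approximations. -/
theorem greedyList_congr {n : ℕ} (hV : ∀ x < n, (V x ↔ V' x))
    (hR : ∀ x < n, ∀ y < n, (R x y ↔ R' x y)) : greedyList V R n = greedyList V' R' n := by
  induction n with
  | zero => rfl
  | succ n ih =>
    rw [greedyList, greedyList, ← ih (fun x hx => hV x (by omega))
      fun x hx y hy => hR x (by omega) y (by omega)]
    have : (V n ∧ ∀ y ∈ greedyList V R n, ¬ R y n) ↔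
        V' n ∧ ∀ y ∈ greedyList V R n, ¬ R' y n := by
      refine and_congr (hV n (by omega)) (forall₂_congr fun y hy => ?_)
      rw [hR y ((mem_greedyList.1 hy).1.trans (Nat.lt_succ_self n)) n (Nat.lt_succ_self n)]
    by_cases h : V n ∧ ∀ y ∈ greedyList V R n, ¬ R y n
    · rw [greedyStep, greedyStep, if_pos h, if_pos (this.1 h)]
    · rw [greedyStep, greedyStep, if_neg h, if_neg (mt this.2 h)]

theorem not_rel_of_mem_greedySet {a b : ℕ} (ha : a ∈ greedySet V R) (hb : b ∈ greedySet V R)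
    (hab : a < b) : ¬ R a b :=
  (mem_greedySet.1 hb).2 a hab ha

/-- A finite greedy set would exclude only finitely many candidates, so a further one beyond its
maximum would have been added. -/
theorem infinite_greedySet (hV : {n | V n}.Infinite) (hR : ∀ y, V y → {n | R y n}.Finite) :
    (greedySet V R).Infinite := by
  intro hfin
  obtain ⟨B, hB⟩ := hfin.bddAbove
  have h₁ : (⋃ y ∈ greedySet V R, {n | R y n}).Finite :=
    hfin.biUnion fun y hy => hR y (mem_greedySet.1 hy).1
  obtain ⟨n, hn, hn'⟩ := (hV.sdiff (h₁.union (Set.finite_Iic B))).nonempty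
  simp only [Set.mem_union, Set.mem_iUnion, Set.mem_ofPred_eq, Set.mem_Iic, not_or, not_exists,
    not_le] at hn'
  exact (hB (mem_greedySet.2 ⟨hn, fun y _ hy => hn'.1 y hy⟩)).not_gt hn'.2

end greedy

/-! ### Reduction of `RSgr` for locally finite graphs to `lim` -/

/-- Adjacency, read off from the code of a graph. -/
def CodeAdj (q : ℕ → ℕ) (x y : ℕ) : Prop :=
  q (2 * Nat.pair x y + 1) = 1 ∨ q (2 * Nat.pair y x + 1) = 1

/-- The distance of `x` and `y` is at most two, as witnessed by vertices in `S`. -/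
def CodeNear (q : ℕ → ℕ) (S : ℕ → Prop) (x y : ℕ) : Prop :=
  CodeAdj q x y ∨ ∃ z, S z ∧ CodeAdj q x z ∧ CodeAdj q y z

theorem codeAdj_code {G : NatGraph} {x y : ℕ} : CodeAdj G.code x y ↔ G.Adj x y := by
  have key : ∀ a b, G.code (2 * Nat.pair a b + 1) = 1 ↔ a < b ∧ G.Adj a b := fun a b => by
    rw [NatGraph.code_two_mul_add_one, charFn_eq_one]
    simp [NatGraph.edgeCodes]
  rw [CodeAdj, key, key, G.adj_comm y x]
  refine ⟨fun h => h.elim And.right And.right, fun h => ?_⟩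
  exact (lt_or_gt_of_ne h.ne).imp (⟨·, h⟩) (⟨·, h⟩)

/-- The stage `m.unpair.2` approximation to the value at `m.unpair.1` of the characteristic
function of a set of vertices of pairwise distance greater than two. -/
noncomputable def greedyApprox (q : ℕ → ℕ) (m : ℕ) : ℕ :=
  charFn {x | x ∈ greedyList (fun x => q (2 * x) = 1) (CodeNear q (· < m.unpair.2)) (x + 1)}
    m.unpair.1

theorem greedyApprox_congr {p q : ℕ → ℕ} {m : ℕ}
    (h : ∀ i < 2 * Nat.pair (m + 1) (m + 1) + 2, p i = q i) :
    greedyApprox p m = greedyApprox q m := by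
  have h1 := Nat.unpair_left_le m
  have h2 := Nat.unpair_right_le m
  have hadj : ∀ x ≤ m, ∀ y ≤ m, (CodeAdj p x y ↔ CodeAdj q x y) := fun x hx y hy => by
    have := pair_le_pair (Nat.le_succ_of_le hx) (Nat.le_succ_of_le hy)
    have := pair_le_pair (Nat.le_succ_of_le hy) (Nat.le_succ_of_le hx)
    rw [CodeAdj, CodeAdj, h _ (by grind), h _ (by grind)]
  refine charFn_congr ?_
  rw [Set.mem_ofPred_eq, Set.mem_ofPred_eq, greedyList_congr]
  · intro x hx
    have := Nat.left_le_pair (m + 1) (m + 1)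
    rw [h _ (by omega)]
  · intro x hx y hy
    refine or_congr (hadj x (by omega) y (by omega)) (exists_congr fun z => ?_)
    refine and_congr_right fun hz => ?_
    rw [hadj x (by omega) z (by omega), hadj y (by omega) z (by omega)]

theorem primrecRel_codeAdj {α : Type*} [Primcodable α] {l : α → List ℕ} {f g : α → ℕ}
    (hl : Primrec l) (hf : Primrec f) (hg : Primrec g) :
    PrimrecPred fun a => CodeAdj (fun i => (l a).getD i 0) (f a) (g a) := by
  have key : ∀ {f g : α → ℕ}, Primrec f → Primrec g →
      PrimrecPred fun a => (l a).getD (2 * Nat.pair (f a) (g a) + 1) 0 = 1 := fun hf hg =>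
    Primrec.eq.comp ((Primrec.list_getD 0).comp hl (Primrec.succ.comp
      (Primrec.nat_mul.comp (Primrec.const 2) (Primrec₂.natPair.comp hf hg)))) (Primrec.const 1)
  exact (key hf hg).or (key hg hf)

/-- The stage bounds the search for a common neighbour, so nearness becomes a bounded quantifier. -/
theorem primrec_greedyApprox :
    Primrec₂ fun (l : List ℕ) m => greedyApprox (fun i => l.getD i 0) m := by
  classical
  have hnear : PrimrecRel fun (y : ℕ) (a : List ℕ × ℕ × ℕ) =>
      CodeNear (fun i => a.1.getD i 0) (· < a.2.1) y a.2.2 := by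
    have h : PrimrecRel fun (z : ℕ) (b : ℕ × List ℕ × ℕ × ℕ) =>
        CodeAdj (fun i => b.2.1.getD i 0) b.1 z ∧ CodeAdj (fun i => b.2.1.getD i 0) b.2.2.2 z := by
      have hl : Primrec fun c : ℕ × ℕ × List ℕ × ℕ × ℕ => c.2.2.1 :=
        Primrec.fst.comp (Primrec.snd.comp Primrec.snd)
      exact (primrecRel_codeAdj hl (Primrec.fst.comp Primrec.snd) Primrec.fst).and
        (primrecRel_codeAdj hl (Primrec.snd.comp (Primrec.snd.comp (Primrec.snd.comp Primrec.snd)))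
          Primrec.fst)
    have hex := h.exists_lt'
    exact (primrecRel_codeAdj (Primrec.fst.comp Primrec.snd) Primrec.fst
      (Primrec.snd.comp (Primrec.snd.comp Primrec.snd))).or
      (hex.comp (Primrec.fst.comp (Primrec.snd.comp Primrec.snd)) Primrec.id)
  have hlist : Primrec fun a : List ℕ × ℕ => greedyList (fun x => a.1.getD (2 * x) 0 = 1)
      (CodeNear (fun i => a.1.getD i 0) (· < a.2.unpair.2)) (a.2.unpair.1 + 1) := by
    have hcond : PrimrecPred fun c : (List ℕ × ℕ) × ℕ × List ℕ =>
        c.1.1.getD (2 * c.2.1) 0 = 1 ∧ ∀ y ∈ c.2.2,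
          ¬ CodeNear (fun i => c.1.1.getD i 0) (· < c.1.2.unpair.2) y c.2.1 := by
      refine PrimrecPred.and ?_ ?_
      · exact Primrec.eq.comp ((Primrec.list_getD 0).comp (Primrec.fst.comp Primrec.fst)
          (Primrec.nat_mul.comp (Primrec.const 2) (Primrec.fst.comp Primrec.snd)))
          (Primrec.const 1)
      · exact hnear.not.forall_mem_list.comp
          (f := fun c : (List ℕ × ℕ) × ℕ × List ℕ => c.2.2)
          (g := fun c => (c.1.1, c.1.2.unpair.2, c.2.1))
          (Primrec.snd.comp Primrec.snd)
          ((Primrec.fst.comp Primrec.fst).pair ((Primrec.snd.comp (Primrec.unpair.comp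
            (Primrec.snd.comp Primrec.fst))).pair (Primrec.fst.comp Primrec.snd)))
    have hrec := Primrec.nat_rec' (f := fun a : List ℕ × ℕ => a.2.unpair.1 + 1)
      (g := fun _ => ([] : List ℕ))
      (h := fun a c => greedyStep (fun x => a.1.getD (2 * x) 0 = 1)
        (CodeNear (fun i => a.1.getD i 0) (· < a.2.unpair.2)) c.1 c.2)
      (Primrec.succ.comp (Primrec.fst.comp (Primrec.unpair.comp Primrec.snd)))
      (Primrec.const [])
      ((Primrec.ite hcond
        (Primrec.list_cons.comp (Primrec.fst.comp Primrec.snd) (Primrec.snd.comp Primrec.snd))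
        (Primrec.snd.comp Primrec.snd)).of_eq fun _ => by
        simp only [greedyStep]; congr)
    refine hrec.of_eq fun a => ?_
    induction a.2.unpair.1 + 1 with
    | zero => rfl
    | succ n ih => exact congrArg (greedyStep _ _ n) ih
  have hmem : PrimrecRel fun (L : List ℕ) (x : ℕ) => ∃ a ∈ L, a = x :=
    Primrec.eq.exists_mem_list
  exact primrec_charFn <| PrimrecPred.of_eq (hmem.comp hlist
    (Primrec.fst.comp (Primrec.unpair.comp Primrec.snd))) fun a => by simp

theorem uniformlyComputable_greedyApprox : UniformlyComputable greedyApprox :=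
  UniformlyComputable.of_use
    (Primrec.nat_add.comp (Primrec.nat_mul.comp (Primrec.const 2)
      (Primrec₂.natPair.comp Primrec.succ Primrec.succ)) (Primrec.const 2))
    primrec_greedyApprox fun _ _ _ h => greedyApprox_congr h

theorem IsLim.unique {f g h : ℕ → ℕ} (hg : IsLim f g) (hh : IsLim f h) : g = h := by
  ext n
  obtain ⟨s, hs⟩ := hg n
  obtain ⟨t, ht⟩ := hh n
  rw [← hs (max s t) (le_max_left _ _), ht (max s t) (le_max_right _ _)]

-- A common neighbour, if there is one, lies below all large stages, and membership of `n` depends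
-- on finitely many pairs only.
open Filter in
theorem isLim_greedyApprox (q : ℕ → ℕ) : IsLim (greedyApprox q)
    (charFn (greedySet (fun x => q (2 * x) = 1) (CodeNear q fun _ => True))) := by
  intro n
  rw [← eventually_atTop]
  have hnear : ∀ x y, ∀ᶠ s in atTop,
      (CodeNear q (· < s) x y ↔ CodeNear q (fun _ => True) x y) := fun x y => by
    by_cases h : ∃ z, CodeAdj q x z ∧ CodeAdj q y z
    · obtain ⟨z, hz⟩ := h
      filter_upwards [eventually_gt_atTop z] with s hs
      exact or_congr_right ⟨fun ⟨z, _, hz⟩ => ⟨z, trivial, hz⟩, fun _ => ⟨z, hs, hz⟩⟩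
    · refine Eventually.of_forall fun s => or_congr_right ?_
      exact ⟨fun ⟨z, _, hz⟩ => (h ⟨z, hz⟩).elim, fun ⟨z, _, hz⟩ => (h ⟨z, hz⟩).elim⟩
  have hall : ∀ᶠ s in atTop, ∀ x ∈ Set.Iio (n + 1), ∀ y ∈ Set.Iio (n + 1),
      (CodeNear q (· < s) x y ↔ CodeNear q (fun _ => True) x y) :=
    (eventually_all_finite (Set.finite_Iio _)).2 fun x _ =>
      (eventually_all_finite (Set.finite_Iio _)).2 fun y _ => hnear x y
  filter_upwards [hall] with s hs
  refine charFn_congr ?_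
  rw [Nat.unpair_pair, Set.mem_ofPred_eq, greedyList_congr (fun _ _ => Iff.rfl) hs]
  rfl

theorem isRSgrSolution_greedySet {G : NatGraph} (hG : G.verts.Infinite)
    (hlf : G.IsLocallyFinite) : G.IsRSgrSolution
      (greedySet (fun x => G.code (2 * x) = 1) (CodeNear G.code fun _ => True)) := by
  have hV : ∀ x, G.code (2 * x) = 1 ↔ x ∈ G.verts := fun x => by
    rw [NatGraph.code_two_mul, charFn_eq_one]
  have hR : ∀ x y, CodeNear G.code (fun _ => True) x y ↔
      G.Adj x y ∨ ∃ z, G.Adj x z ∧ G.Adj y z := by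
    simp [CodeNear, codeAdj_code]
  set H := greedySet (fun x => G.code (2 * x) = 1) (CodeNear G.code fun _ => True)
  have hfar : ∀ a ∈ H, ∀ b ∈ H, a ≠ b → ¬ G.Adj a b ∧ ∀ z, G.Adj a z → ¬ G.Adj b z := by
    have key : ∀ a ∈ H, ∀ b ∈ H, a < b → ¬ G.Adj a b ∧ ∀ z, G.Adj a z → ¬ G.Adj b z :=
      fun a ha b hb hab => by
        simpa [hR, not_or] using not_rel_of_mem_greedySet ha hb hab
    intro a ha b hb hab
    rcases lt_or_gt_of_ne hab with h | h
    · exact key a ha b hb h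
    · have := key b hb a ha h
      exact ⟨fun h => this.1 h.symm, fun z h₁ h₂ => this.2 z h₂ h₁⟩
  refine ⟨⟨infinite_greedySet (by simpa [hV] using hG) fun y hy => ?_, fun x hx => ?_,
    fun v _ => Or.inr ?_⟩, fun v hv => Or.inr ?_⟩
  -- The ball of radius two around `y` is finite.
  · have hy' := hlf y ((hV y).1 hy)
    refine (hy'.union (hy'.biUnion fun z hz => hlf z (G.edge_vert hz.symm))).subset
      fun n hn => ?_
    rcases (hR y n).1 hn with h | ⟨z, hz, hnz⟩
    · exact Or.inl h
    · exact Or.inr (Set.mem_biUnion hz hnz.symm)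
  · exact (hV x).1 (mem_greedySet.1 hx).1
  · refine Set.encard_le_one_iff.2 fun a b ha hb => ?_
    by_contra hab
    exact (hfar a ha.1 b hb.1 hab).2 v ha.2.symm hb.2.symm
  · refine Set.eq_empty_iff_forall_notMem.2 fun a ha => ?_
    exact (hfar v hv a ha.1 ha.2.ne).1 ha.2

theorem RSgrLF_strongReducible_limProblem : RSgrLF.StrongReducible limProblem := by
  obtain ⟨Φ, hΦ⟩ := uniformlyComputable_greedyApprox
  refine ⟨Φ, .oracle, ?_⟩
  rintro _ ⟨⟨G, hG, rfl⟩, K, hK, hGK⟩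
  obtain rfl := NatGraph.code_injective hGK
  have hlim := isLim_greedyApprox G.code
  refine ⟨_, ⟨_, hlim⟩, hΦ _, fun g hg => ⟨g, ?_, maps_oracle g⟩⟩
  exact ⟨G, _, rfl, hlim.unique hg ▸ rfl, isRSgrSolution_greedySet hG hK⟩

theorem RSgLF_strongReducible_RSgrLF : RSgLF.StrongReducible RSgrLF :=
  ⟨.oracle, .oracle, fun f hf => ⟨f, hf, maps_oracle f,
    fun g ⟨G, H, hG, hH, h⟩ => ⟨g, ⟨G, H, hG, hH, h.1⟩, maps_oracle g⟩⟩⟩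

/-! ### Reduction of `lim` to `RSg` for locally finite graphs -/

/-- The finite sequence with number `x`. -/
abbrev seqOf (x : ℕ) : List ℕ := Denumerable.ofNat (List ℕ) x

/-- The number of the sequence of the first `s` values at stage `s`. -/
def stageCode (f : ℕ → ℕ) (s : ℕ) : ℕ :=
  Encodable.encode ((List.range s).map fun i => f (Nat.pair i s))

/-- `x` is the number of a sequence of values at the stage given by its length. -/
def IsStage (f : ℕ → ℕ) (x : ℕ) : Prop :=
  ∀ i < (seqOf x).length, (seqOf x).getD i 0 = f (Nat.pair i (seqOf x).length)

/-- The value of `f` at some number up to that of the stage `x` changes at the stage `y`. -/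
def SeesChange (f : ℕ → ℕ) (x y : ℕ) : Prop :=
  (seqOf x).length < (seqOf y).length ∧ ∃ n < (seqOf x).length + 1,
    -- The length of `y` is positive by the first conjunct, so the subtraction is not truncated.
    f (Nat.pair n (seqOf y).length) ≠ f (Nat.pair n ((seqOf y).length - 1))

/-- The graph on the stages in which a stage is adjacent to the later ones at which it
sees a change. -/
def limGraph (f : ℕ → ℕ) : NatGraph where
  verts := {x | IsStage f x}
  Adj x y := IsStage f x ∧ IsStage f y ∧ (SeesChange f x y ∨ SeesChange f y x)
  adj_sub {x y} h := by
    rw [SimpleGraph.top_adj]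
    rintro rfl
    rcases h.2.2 with h | h <;> exact h.1.false
  edge_vert h := h.1
  symm := ⟨fun _ _ h => ⟨h.2.1, h.1, h.2.2.symm⟩⟩

section limGraph

variable {f g : ℕ → ℕ}

theorem length_stageCode (f : ℕ → ℕ) (s : ℕ) : (seqOf (stageCode f s)).length = s := by
  simp [seqOf, stageCode]

theorem isStage_stageCode (f : ℕ → ℕ) (s : ℕ) : IsStage f (stageCode f s) := by
  intro i hi
  rw [length_stageCode] at hi ⊢
  simp [seqOf, stageCode, List.getD_eq_getElem?_getD, hi]

/-- Hence a vertex is determined by its length, and bounded length means finitely many vertices. -/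
theorem IsStage.eq_stageCode {x : ℕ} (hx : IsStage f x) :
    x = stageCode f (seqOf x).length := by
  have h : seqOf x = (List.range (seqOf x).length).map fun i =>
      f (Nat.pair i (seqOf x).length) := by
    refine List.ext_getElem (by simp) fun i hi _ => ?_
    have := hx i hi
    rw [List.getD_eq_getElem _ _ hi] at this
    simpa using this
  rw [stageCode, ← h]
  exact (Denumerable.encode_ofNat x).symm

theorem infinite_verts_limGraph (f : ℕ → ℕ) : (limGraph f).verts.Infinite :=
  Set.infinite_of_injective_forall_mem
    (Function.LeftInverse.injective (g := fun x => (seqOf x).length) (length_stageCode f))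
    (isStage_stageCode f)

open Filter in
theorem IsLim.isLocallyFinite_limGraph (h : IsLim f g) : (limGraph f).IsLocallyFinite := by
  intro v _
  have hall : ∀ᶠ s in atTop, ∀ n ∈ Set.Iio ((seqOf v).length + 1), f (Nat.pair n s) = g n :=
    (eventually_all_finite (Set.finite_Iio _)).2 fun n _ => eventually_atTop.2 (h n)
  obtain ⟨T, hT⟩ := eventually_atTop.1 hall
  -- A longer neighbour `y` could not be the earlier stage, and both its stage and the preceding one
  -- would be at least `T`, where the relevant values are constant.
  refine ((Set.finite_Iic ((seqOf v).length + T)).image (stageCode f)).subset fun y hy => ?_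
  refine ⟨_, ?_, hy.2.1.eq_stageCode.symm⟩
  rw [Set.mem_Iic]
  by_contra! hlt
  rcases hy.2.2 with ⟨_, n, hn, hne⟩ | ⟨h', _⟩
  · exact hne (by rw [hT _ (by omega) n hn, hT _ (by omega) n hn])
  · omega

/-- Two elements of a solution determine all values up to the length of the shorter one. -/
theorem IsLim.eq_of_mem_solution (h : IsLim f g) {H : Set ℕ}
    (hH : (limGraph f).IsRSgSolution H) {n x y : ℕ} (hx : x ∈ H) (hy : y ∈ H)
    (hn : n ≤ (seqOf x).length) (hxy : (seqOf x).length < (seqOf y).length) :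
    (seqOf y).getD n 0 = g n := by
  rw [hH.2.1 hy n (by omega)]
  by_contra hne
  -- A value that is not yet the limit must change later.
  have hchange : ∃ t > (seqOf y).length, f (Nat.pair n t) ≠ f (Nat.pair n (t - 1)) := by
    by_contra! hconst
    have hc : ∀ t ≥ (seqOf y).length, f (Nat.pair n t) = f (Nat.pair n (seqOf y).length) := by
      intro t ht
      induction t, ht using Nat.le_induction with
      | base => rfl
      | succ t ht ih => rw [hconst (t + 1) (by omega), Nat.add_sub_cancel, ih]
    obtain ⟨s, hs⟩ := h n
    exact hne ((hc _ (le_max_left _ s)).symm.trans (hs _ (le_max_right _ s)))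
  obtain ⟨t, ht, hft⟩ := hchange
  have hadj : ∀ z ∈ H, n ≤ (seqOf z).length → (seqOf z).length < t →
      z ∈ H ∩ (limGraph f).neighborSet (stageCode f t) := fun z hz hnz hzt => by
    refine ⟨hz, isStage_stageCode f t, hH.2.1 hz, Or.inr ?_⟩
    rw [SeesChange, length_stageCode]
    exact ⟨hzt, n, by omega, hft⟩
  -- The stage `t` sees both `x` and `y` in `H`: local finiteness excludes infinitely many
  -- neighbours, and at most one would force `x = y`.
  rcases hH.2.2 _ (isStage_stageCode f t) with hinf | hle
  · exact hinf ((h.isLocallyFinite_limGraph _ (isStage_stageCode f t)).subset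
      Set.inter_subset_right)
  · have := Set.encard_le_one_iff.1 hle x y (hadj x hx hn (by omega))
      (hadj y hy (by omega) ht)
    exact hxy.ne (by rw [this])

theorem exists_mem_solution {H : Set ℕ} (hH : (limGraph f).IsRSgSolution H) (n : ℕ) :
    ∃ x ∈ H, ∃ y ∈ H, n ≤ (seqOf x).length ∧ (seqOf x).length < (seqOf y).length := by
  have hinj : Set.InjOn (fun x => (seqOf x).length) H := fun x hx y hy hxy => by
    rw [(hH.2.1 hx).eq_stageCode, (hH.2.1 hy).eq_stageCode]
    exact congrArg _ hxy
  have hinf := hH.1.image hinj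
  obtain ⟨_, ⟨x, hx, rfl⟩, hnx⟩ := hinf.exists_gt n
  obtain ⟨_, ⟨y, hy, rfl⟩, hxy⟩ := hinf.exists_gt (seqOf x).length
  exact ⟨x, hx, y, hy, hnx.le, hxy⟩

end limGraph

/-! ### Computability of the graph of stages -/

theorem code_limGraph_eq_one {f : ℕ → ℕ} {n : ℕ} : (limGraph f).code n = 1 ↔
    (n % 2 = 0 ∧ IsStage f (n / 2)) ∨ (n % 2 ≠ 0 ∧ (n / 2).unpair.1 < (n / 2).unpair.2 ∧
      IsStage f (n / 2).unpair.1 ∧ IsStage f (n / 2).unpair.2 ∧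
      (SeesChange f (n / 2).unpair.1 (n / 2).unpair.2 ∨
        SeesChange f (n / 2).unpair.2 (n / 2).unpair.1)) := by
  by_cases h : n % 2 = 0
  · simp [NatGraph.code, join, h, limGraph, charFn_eq_one]
  · have h₁ : n % 2 = 1 := by omega
    simp [NatGraph.code, join, h₁, limGraph, charFn_eq_one, NatGraph.edgeCodes]

theorem code_limGraph_congr {p q : ℕ → ℕ} {n : ℕ}
    (h : ∀ i < Nat.pair (n + 1) (n + 1) + 1, p i = q i) :
    (limGraph p).code n = (limGraph q).code n := by
  -- A sequence is no longer than its number, so every query has both coordinates at most `n + 1`.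
  have hlen : ∀ x, (seqOf x).length ≤ x := fun x => by
    simpa using Encodable.length_le_encode (seqOf x)
  have h' : ∀ i ≤ n + 1, ∀ j ≤ n + 1, p (Nat.pair i j) = q (Nat.pair i j) := fun i hi j hj =>
    h _ (Nat.lt_succ_of_le (pair_le_pair hi hj))
  have hstage : ∀ x ≤ n, (IsStage p x ↔ IsStage q x) := fun x hx =>
    forall₂_congr fun i hi => by
      have := hlen x
      rw [h' _ (by omega) _ (by omega)]
  have hsees : ∀ x ≤ n, ∀ y ≤ n, (SeesChange p x y ↔ SeesChange q x y) := fun x hx y hy =>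
    and_congr_right fun _ => exists_congr fun i => and_congr_right fun hi => by
      have := hlen x
      have := hlen y
      rw [h' _ (by omega) _ (by omega), h' _ (by omega) _ (by omega)]
  have h₂ : n / 2 ≤ n := Nat.div_le_self n 2
  have hl : (n / 2).unpair.1 ≤ n := (Nat.unpair_left_le _).trans h₂
  have hr : (n / 2).unpair.2 ≤ n := (Nat.unpair_right_le _).trans h₂
  have key : (limGraph p).code n = 1 ↔ (limGraph q).code n = 1 := by
    rw [code_limGraph_eq_one, code_limGraph_eq_one, hstage _ h₂, hstage _ hl, hstage _ hr,
      hsees _ hl _ hr, hsees _ hr _ hl]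
  have h01 : ∀ f, (limGraph f).code n = 0 ∨ (limGraph f).code n = 1 := fun f => by
    simp only [NatGraph.code, join, charFn]; split_ifs <;> simp
  rcases h01 p with hp | hp <;> rcases h01 q with hq | hq <;> simp_all

section primrec

variable {α : Type*} [Primcodable α] {l : α → List ℕ} {u v : α → ℕ}

theorem primrec_length_seqOf : Primrec fun x => (seqOf x).length :=
  Primrec.list_length.comp (Primrec.ofNat _)

theorem primrecPred_isStage (hl : Primrec l) (hu : Primrec u) :
    PrimrecPred fun a => IsStage (fun i => (l a).getD i 0) (u a) := by
  have h : PrimrecRel fun (i : ℕ) (a : List ℕ × ℕ) =>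
      (seqOf a.2).getD i 0 = a.1.getD (Nat.pair i (seqOf a.2).length) 0 := by
    refine Primrec.eq.comp ((Primrec.list_getD 0).comp
      ((Primrec.ofNat _).comp (Primrec.snd.comp Primrec.snd)) Primrec.fst) ?_
    exact (Primrec.list_getD 0).comp (Primrec.fst.comp Primrec.snd) (Primrec₂.natPair.comp
      Primrec.fst (primrec_length_seqOf.comp (Primrec.snd.comp Primrec.snd)))
  exact h.forall_lt'.comp (primrec_length_seqOf.comp hu) (hl.pair hu)

theorem primrecPred_seesChange (hl : Primrec l) (hu : Primrec u) (hv : Primrec v) :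
    PrimrecPred fun a => SeesChange (fun i => (l a).getD i 0) (u a) (v a) := by
  have h : PrimrecRel fun (n : ℕ) (a : List ℕ × ℕ) =>
      a.1.getD (Nat.pair n a.2) 0 ≠ a.1.getD (Nat.pair n (a.2 - 1)) 0 := by
    have hfst : Primrec fun c : ℕ × List ℕ × ℕ => c.2.1 := Primrec.fst.comp Primrec.snd
    have hsnd : Primrec fun c : ℕ × List ℕ × ℕ => c.2.2 := Primrec.snd.comp Primrec.snd
    exact (Primrec.eq.comp
      ((Primrec.list_getD 0).comp hfst (Primrec₂.natPair.comp Primrec.fst hsnd))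
      ((Primrec.list_getD 0).comp hfst (Primrec₂.natPair.comp Primrec.fst
        (Primrec.nat_sub.comp hsnd (Primrec.const 1))))).not
  have hu' := primrec_length_seqOf.comp hu
  have hv' := primrec_length_seqOf.comp hv
  exact (Primrec.nat_lt.comp hu' hv').and
    (h.exists_lt'.comp (Primrec.succ.comp hu') (hl.pair hv'))

end primrec

theorem primrec_code_limGraph :
    Primrec₂ fun (l : List ℕ) n => (limGraph fun i => l.getD i 0).code n := by
  classical
  have hl : Primrec fun a : List ℕ × ℕ => a.1 := Primrec.fst
  have hn : Primrec fun a : List ℕ × ℕ => a.2 / 2 :=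
    Primrec.nat_div.comp Primrec.snd (Primrec.const 2)
  have h₁ : Primrec fun a : List ℕ × ℕ => (a.2 / 2).unpair.1 :=
    Primrec.fst.comp (Primrec.unpair.comp hn)
  have h₂ : Primrec fun a : List ℕ × ℕ => (a.2 / 2).unpair.2 :=
    Primrec.snd.comp (Primrec.unpair.comp hn)
  have hpar : PrimrecPred fun a : List ℕ × ℕ => a.2 % 2 = 0 :=
    Primrec.eq.comp (Primrec.nat_mod.comp Primrec.snd (Primrec.const 2)) (Primrec.const 0)
  have h : PrimrecPred fun a : List ℕ × ℕ => (limGraph fun i => a.1.getD i 0).code a.2 = 1 :=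
    PrimrecPred.of_eq ((hpar.and (primrecPred_isStage hl hn)).or (hpar.not.and
      ((Primrec.nat_lt.comp h₁ h₂).and ((primrecPred_isStage hl h₁).and
        ((primrecPred_isStage hl h₂).and ((primrecPred_seesChange hl h₁ h₂).or
          (primrecPred_seesChange hl h₂ h₁)))))))
      fun _ => code_limGraph_eq_one.symm
  refine (Primrec.ite h (Primrec.const 1) (Primrec.const 0)).of_eq fun a => ?_
  simp only [NatGraph.code, join, charFn]
  split_ifs <;> simp_all

theorem uniformlyComputable_code_limGraph :
    UniformlyComputable fun f => (limGraph f).code :=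
  UniformlyComputable.of_use
    (Primrec.succ.comp (Primrec₂.natPair.comp Primrec.succ Primrec.succ))
    primrec_code_limGraph fun _ _ _ h => code_limGraph_congr h

/-- The functional that recovers the limit from a solution: it searches for two sufficiently
long sequences in the solution and reads off the value from the longer one. -/
theorem exists_functional_limit : ∃ Ψ : TuringFunctional, ∀ f g : ℕ → ℕ, IsLim f g →
    ∀ H, (limGraph f).IsRSgSolution H → Ψ.Maps (charFn H) g := by
  classical
  have hleft : Primrec fun m : ℕ => m.unpair.1 := Primrec.fst.comp Primrec.unpair
  have hright : Primrec fun m : ℕ => m.unpair.2 := Primrec.snd.comp Primrec.unpair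
  have hx := hleft.comp hright
  have hy := hright.comp hright
  -- The argument packs the oracle's answers at `x` and `y` with the triple `n`, `x`, `y`; 0 signals
  -- success.
  let test : ℕ → ℕ := fun c => if c.unpair.1.unpair.1 = 1 ∧ c.unpair.1.unpair.2 = 1 ∧
    c.unpair.2.unpair.1 ≤ (seqOf c.unpair.2.unpair.2.unpair.1).length ∧
    (seqOf c.unpair.2.unpair.2.unpair.1).length < (seqOf c.unpair.2.unpair.2.unpair.2).length
    then 0 else 1
  have htest : Primrec test := by
    refine Primrec.ite ?_ (Primrec.const 0) (Primrec.const 1)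
    have hlx := primrec_length_seqOf.comp (hx.comp hright)
    have hly := primrec_length_seqOf.comp (hy.comp hright)
    exact (Primrec.eq.comp (hleft.comp hleft) (Primrec.const 1)).and
      ((Primrec.eq.comp (hright.comp hleft) (Primrec.const 1)).and
        ((Primrec.nat_le.comp (hleft.comp hright) hlx).and (Primrec.nat_lt.comp hlx hly)))
  have hF := (UniformlyComputable.of_primrec htest).comp
    (((UniformlyComputable.oracle.comp (.of_primrec hx)).pair
      (UniformlyComputable.oracle.comp (.of_primrec hy))).pair (.of_primrec Primrec.id))
  have hG := UniformlyComputable.of_primrec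
    ((Primrec.list_getD 0).comp ((Primrec.ofNat (List ℕ)).comp hy) hleft)
  obtain ⟨Ψ, hΨ⟩ := UniformlyComputable.exists_search hF hG
  refine ⟨Ψ, fun f g hfg H hH => hΨ _ _ (fun n => ?_) fun n k hk => ?_⟩
  · obtain ⟨x, hxH, y, hyH, hnx, hxy⟩ := exists_mem_solution hH n
    exact ⟨Nat.pair x y, by simp [test, charFn_eq_one, hxH, hyH, hnx, hxy]⟩
  · simp only [test, id, Nat.unpair_pair, charFn_eq_one] at hk ⊢
    split_ifs at hk with h
    -- Whichever pair the search finds, it yields the limit.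
    exact hfg.eq_of_mem_solution hH h.1 h.2.1 h.2.2.1 h.2.2.2

theorem limProblem_strongReducible_RSgLF : limProblem.StrongReducible RSgLF := by
  obtain ⟨Φ, hΦ⟩ := uniformlyComputable_code_limGraph
  obtain ⟨Ψ, hΨ⟩ := exists_functional_limit
  refine ⟨Φ, Ψ, ?_⟩
  rintro f ⟨g, hfg⟩
  refine ⟨(limGraph f).code, ⟨⟨_, infinite_verts_limGraph f, rfl⟩, _,
    hfg.isLocallyFinite_limGraph, rfl⟩, hΦ f, ?_⟩
  rintro _ ⟨G, H, hG, rfl, hH⟩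
  obtain rfl := NatGraph.code_injective hG
  exact ⟨g, hfg, hΨ f g hfg H hH⟩

end Weihrauch

theorem mainTheorem12 :
    Weihrauch.RSgLF.StrongEquiv Weihrauch.RSgrLF ∧
      Weihrauch.RSgrLF.StrongEquiv Weihrauch.limProblem ∧
      Weihrauch.RSgLF.StrongEquiv Weihrauch.limProblem :=
  have h₁ := Weihrauch.RSgLF_strongReducible_RSgrLF
  have h₂ := Weihrauch.RSgrLF_strongReducible_limProblem
  have h₃ := Weihrauch.limProblem_strongReducible_RSgLF
  ⟨⟨h₁, h₂.trans h₃⟩, ⟨h₂, h₃.trans h₁⟩, ⟨h₁.trans h₂, h₃⟩⟩
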